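/- Let $G$ be a finite group, let $K_1,\dots,K_s$ be its conjugacy classes, with arbitrarily chosen representatives $g_i\in K_i$, and let $\mathrm{Irr}(G)$ be the set of its irreducible complex characters. Define Harada's number and $c(G)$ by $$h(G)=\frac{\prod_{i=1}^s |K_i|}{\prod_{\chi\in\mathrm{Irr}(G)}\chi(1)},\qquad c(G)=\prod_{i=1}^s |C_G(g_i)|,$$ where $C_G(g_i)$ is the centralizer of $g_i$ in $G$. Let $Z(\mathbb{C}G)$ be the center of the complex group algebra, with the class sums $[K_i]=\sum_{g\in K_i}[g]$ as basis, let $\overline{\sum_g c_g[g]}=\sum_g\overline{c_g}\,[g^{-1}]$, and for $u,v\in Z(\mathbb{C}G)$ let $\langle u|v\rangle$ be the trace of the linear map $w\mapsto \overline{u}\,v\,w$ on $Z(\mathbb{C}G)$. Put $$\gamma(G)=\left|\det\big(\langle [K_i]|[K_j]\rangle\big)_{i,j=1,\dots,s}\right|.$$ Then $\gamma(G)\in\mathbb{Z}$ and $\gamma(G)=h(G)^2c(G)$. Consequently, $h(G)\in\mathbb{Z}$ if and only if $c(G)$ divides $\gamma(G)$ in $\mathbb{Z}$. -/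

import Mathlib

open scoped BigOperators

noncomputable section

namespace Harada

/-! ### Irreducible complex characters -/

section Characters

variable (G : Type*) [Group G]

/-- The set `Irr(G)` of irreducible complex characters of `G`: the functions `G → ℂ` which are the
character (trace function) of an irreducible complex representation of `G` of finite degree.
Up to isomorphism the underlying space of such a representation is some `ℂⁿ`. -/
def Irr : Set (G → ℂ) :=
  {χ | ∃ (n : ℕ) (ρ : Representation ℂ G (Fin n → ℂ)), ρ.IsIrreducible ∧ ρ.character = χ}

variable {G}

/-- Irreducibility is transported along an isomorphism of representations. -/
theorem isIrreducible_of_equiv {V W : Type*} [AddCommGroup V] [Module ℂ V] [AddCommGroup W]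
    [Module ℂ W] {ρ : Representation ℂ G V} {σ : Representation ℂ G W} (e : V ≃ₗ[ℂ] W)
    (he : ∀ g v, e (ρ g v) = σ g (e v)) (h : ρ.IsIrreducible) : σ.IsIrreducible := by
  have he' : ∀ g w, e.symm (σ g w) = ρ g (e.symm w) := by
    intro g w
    rw [LinearEquiv.symm_apply_eq, he, LinearEquiv.apply_symm_apply]
  let f : Subrepresentation σ ≃o Subrepresentation ρ :=
    { toFun := fun S => ⟨S.toSubmodule.comap e.toLinearMap, fun g v hv => by
        have := S.apply_mem_toSubmodule g hv
        simpa [he] using this⟩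
      invFun := fun S => ⟨S.toSubmodule.comap e.symm.toLinearMap, fun g v hv => by
        have := S.apply_mem_toSubmodule g hv
        simpa [he'] using this⟩
      left_inv := fun S => by
        apply Subrepresentation.toSubmodule_injective
        ext v; simp
      right_inv := fun S => by
        apply Subrepresentation.toSubmodule_injective
        ext v; simp
      map_rel_iff' := by
        intro S T
        constructor
        · intro hST w hw
          have : e.symm w ∈ S.toSubmodule.comap e.toLinearMap := by
            change e (e.symm w) ∈ S.toSubmodule
            rw [e.apply_symm_apply]
            exact hw
          have := hST this
          change e (e.symm w) ∈ T.toSubmodule at this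
          rw [e.apply_symm_apply] at this
          exact this
        · intro hST v hv
          exact hST hv }
  have := h
  exact f.isSimpleOrder_iff.mpr h

/-- The character of any finite-dimensional irreducible representation belongs to `Irr G`. -/
theorem character_mem_Irr {V : Type*} [AddCommGroup V] [Module ℂ V] [FiniteDimensional ℂ V]
    (ρ : Representation ℂ G V) (h : ρ.IsIrreducible) : ρ.character ∈ Irr G := by
  let e : V ≃ₗ[ℂ] (Fin (Module.finrank ℂ V) → ℂ) := (Module.finBasis ℂ V).equivFun
  let σ : Representation ℂ G (Fin (Module.finrank ℂ V) → ℂ) :=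
    { toFun := fun g => e.conj (ρ g)
      map_one' := by ext; simp
      map_mul' := fun g k => by ext; simp [LinearEquiv.conj_apply] }
  refine ⟨_, σ, isIrreducible_of_equiv (ρ := ρ) e (fun g v => ?_) h, ?_⟩
  · simp [σ, LinearEquiv.conj_apply]
  · funext g
    exact LinearMap.trace_conj' (ρ g) e

/-- The degree `χ(1)` of an irreducible character is nonzero. -/
theorem Irr_apply_one_ne_zero {χ : G → ℂ} (h : χ ∈ Irr G) : χ 1 ≠ 0 := by
  obtain ⟨n, ρ, hρ, rfl⟩ := h
  rw [Representation.char_one, Module.finrank_fin_fun, Nat.cast_ne_zero]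
  rintro rfl
  have := hρ
  refine bot_ne_top (α := Subrepresentation ρ) ?_
  apply Subrepresentation.toSubmodule_injective
  exact Subsingleton.elim _ _

/-- A finite group has only finitely many irreducible characters. -/
theorem Irr_finite [Fintype G] : (Irr G).Finite := by
  classical
  have : Invertible (Nat.card G : ℂ) :=
    invertibleOfNonzero (Nat.cast_ne_zero.mpr Nat.card_pos.ne')
  have key : ∀ χ ψ : Irr G, (Nat.card G : ℂ)⁻¹ * ∑ g : G, χ.1 g * ψ.1 g⁻¹ =
      if χ = ψ then 1 else 0 := by
    rintro ⟨χ, n, ρ, hρ, rfl⟩ ⟨ψ, m, σ, hσ, rfl⟩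
    have := hρ
    have := hσ
    have h := Representation.char_orthonormal ρ σ
    by_cases hc : ρ.character = σ.character
    · have h' := Representation.char_orthonormal ρ ρ
      rw [if_pos ⟨Representation.Equiv.refl ρ⟩] at h'
      rw [if_pos (Subtype.ext hc)]
      change _ * ∑ g : G, ρ.character g * σ.character g⁻¹ = _
      rw [← hc]
      exact h'
    · have hne : ¬ Nonempty (Representation.Equiv σ ρ) := by
        rintro ⟨φ⟩
        exact hc (Representation.char_iso φ).symm
      rw [if_neg hne] at h
      rw [if_neg fun hh => hc (congrArg Subtype.val hh)]
      exact h
  have hli : LinearIndependent ℂ (fun χ : Irr G => χ.1) := by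
    rw [linearIndependent_iff']
    intro s c hc ψ hψ
    have h1 : (Nat.card G : ℂ)⁻¹ * ∑ g : G, (∑ χ ∈ s, c χ • χ.1) g * ψ.1 g⁻¹ = c ψ := by
      calc _ = ∑ χ ∈ s, c χ * ((Nat.card G : ℂ)⁻¹ * ∑ g : G, χ.1 g * ψ.1 g⁻¹) := by
            simp only [Finset.sum_apply, Pi.smul_apply, smul_eq_mul, Finset.sum_mul,
              Finset.mul_sum]
            rw [Finset.sum_comm]
            refine Finset.sum_congr rfl fun χ _ => Finset.sum_congr rfl fun g _ => ?_
            ring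
        _ = c ψ := by
            simp only [key]
            simp [hψ]
    rw [hc] at h1
    simpa using h1.symm
  exact Set.finite_coe_iff.mp hli.finite

instance [Fintype G] : Fintype (Irr G) := Irr_finite.fintype

end Characters

/-! ### The Hermitian form on the center of the group algebra -/

section GroupAlgebra

variable {G : Type*} [Group G] [Fintype G]

/-- The semilinear map `∑ c_g [g] ↦ ∑ conj(c_g) [g⁻¹]` on the group algebra `ℂG`. -/
def bar (u : MonoidAlgebra ℂ G) : MonoidAlgebra ℂ G :=
  ∑ g : G, MonoidAlgebra.single g⁻¹ (starRingEnd ℂ (u.coeff g))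

theorem bar_single (g : G) (c : ℂ) :
    bar (MonoidAlgebra.single g c) = MonoidAlgebra.single g⁻¹ (starRingEnd ℂ c) := by
  classical
  unfold bar
  rw [Finset.sum_eq_single g]
  · simp
  · intro b _ hb
    simp [hb.symm]
  · simp

theorem bar_zero : bar (0 : MonoidAlgebra ℂ G) = 0 := by simp [bar]

theorem bar_add (u v : MonoidAlgebra ℂ G) : bar (u + v) = bar u + bar v := by
  simp [bar, MonoidAlgebra.single_add, Finset.sum_add_distrib]

theorem bar_bar (u : MonoidAlgebra ℂ G) : bar (bar u) = u := by
  induction u using MonoidAlgebra.induction_linear with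
  | zero => simp [bar_zero]
  | add x y hx hy => rw [bar_add, bar_add, hx, hy]
  | single g c => simp [bar_single]

theorem bar_mul (u v : MonoidAlgebra ℂ G) : bar (u * v) = bar v * bar u := by
  induction u using MonoidAlgebra.induction_linear with
  | zero => simp [bar_zero]
  | add x y hx hy => rw [add_mul, bar_add, hx, hy, bar_add, mul_add]
  | single g c =>
    induction v using MonoidAlgebra.induction_linear with
    | zero => simp [bar_zero]
    | add x y hx hy => rw [mul_add, bar_add, hx, hy, bar_add, add_mul]
    | single k d => simp [bar_single, MonoidAlgebra.single_mul_single, mul_comm]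

variable (G) in
/-- The center `Z(ℂG)` of the group algebra. -/
abbrev Center : Type _ := Subalgebra.center ℂ (MonoidAlgebra ℂ G)

/-- The restriction of `bar` to the center `Z(ℂG)`. -/
def centerBar (u : Center G) : Center G :=
  ⟨bar (u : MonoidAlgebra ℂ G), by
    rw [Subalgebra.mem_center_iff]
    intro w
    have h := Subalgebra.mem_center_iff.mp u.2 (bar w)
    have h' := congrArg bar h
    rw [bar_mul, bar_mul, bar_bar] at h'
    exact h'.symm⟩

/-- The Hermitian form `⟨u | v⟩ = tr_{Z(ℂG)} (ū v)` on `Z(ℂG)`, where `tr_{Z(ℂG)} w` is the trace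
of multiplication by `w` on `Z(ℂG)`. -/
def form (u v : Center G) : ℂ := Algebra.trace ℂ (Center G) (centerBar u * v)

/-- The Gram matrix `Γ(B) = (⟨v i | v j⟩)` of a family of vectors of `Z(ℂG)`. -/
def gramMatrix {ι : Type*} (v : ι → Center G) : Matrix ι ι ℂ :=
  Matrix.of fun i j => form (v i) (v j)

/-- The absolute Gram determinant `γ(B) = |det Γ(B)|` of a finite family of vectors of `Z(ℂG)`. -/
def absGramDet {ι : Type*} [Fintype ι] [DecidableEq ι] (v : ι → Center G) : ℝ :=
  ‖(gramMatrix v).det‖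

variable [DecidableEq G]

/-- The class sum `[K] = ∑_{g ∈ K} [g]` as an element of the center `Z(ℂG)`. -/
def classSum (K : ConjClasses G) : Center G :=
  ⟨∑ g : G with ConjClasses.mk g = K, MonoidAlgebra.of ℂ G g, by
    rw [Subalgebra.mem_center_iff]
    intro w
    induction w using MonoidAlgebra.induction_linear with
    | zero => simp
    | add x y hx hy => rw [add_mul, hx, hy, mul_add]
    | single k c =>
      rw [Finset.mul_sum, Finset.sum_mul]
      refine Finset.sum_equiv (MulAut.conj k).toEquiv ?_ ?_
      · intro g
        simp only [Finset.mem_filter, Finset.mem_univ, true_and, MulEquiv.toEquiv_eq_coe, EquivLike.coe_coe]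
        have : ConjClasses.mk (MulAut.conj k g) = ConjClasses.mk g := by
          rw [ConjClasses.mk_eq_mk_iff_isConj, isConj_comm, isConj_iff]
          exact ⟨k, by simp⟩
        rw [this]
      · intro g _
        simp [MonoidAlgebra.single_mul_single]⟩

variable (G)

/-- `γ(G)`: the absolute Gram determinant of the family of class sums in `Z(ℂG)`. -/
def gammaG : ℝ := absGramDet (classSum : ConjClasses G → Center G)

/-- Harada's number `h(G) = ∏_K |K| / ∏_χ χ(1)`. -/
def haradaNumber : ℂ :=
  (∏ K : ConjClasses G, (Nat.card K.carrier : ℂ)) / ∏ χ : Irr G, (χ : G → ℂ) 1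

variable {G}

/-- `c(G) = ∏_K |C_G(g_K)|`, where `g` is a choice of a representative of each conjugacy class. -/
def centralizerProd (g : ConjClasses G → G) : ℕ :=
  ∏ K : ConjClasses G, Nat.card (Subgroup.centralizer ({g K} : Set G))

end GroupAlgebra

end Harada

end

noncomputable section

namespace Harada

open Module

variable {G : Type*} [Group G] [Fintype G]

/-! ### Central characters -/

/-! The central characters `ω_χ` identify `Z(ℂG)` with `ℂ^Irr(G)` (`centralEval_bijective`), so the
trace of multiplication by `z` is `∑_χ ω_χ(z)`. Since `ω_χ([K]) = |K| χ(g_K) / χ(1)`, the Gram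
matrix is `(D Y C)ᵀ (D X C)`, where `X` is the character table, `Y` its values at inverses, `D =
diag(1/χ(1))` and `C = diag(|K|)`. Here `det C * det D = h(G)`. Row orthogonality `X C Yᵀ = |G| I`
and `|K| |C_G(g_K)| = |G|` give `det X * det Y = c(G)`. Hence the determinant is `h(G)² c(G)`
(`det_gramMatrix_classSum`).

It is an integer because class sums have integer coefficients, and nonnegative because `h(G)` is
rational. If `c(G)` divides it, then `h(G)²` is an integer, hence so is the rational number `h(G)`.
-/

/-- The linear functional `∑ u_g [g] ↦ χ(1)⁻¹ ∑ u_g χ(g)` on the group algebra. -/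
def centralValue (χ : G → ℂ) : MonoidAlgebra ℂ G →ₗ[ℂ] ℂ where
  toFun u := (χ 1)⁻¹ * ∑ g : G, u.coeff g * χ g
  map_add' u v := by simp [add_mul, Finset.sum_add_distrib, mul_add]
  map_smul' c u := by simp [mul_assoc, Finset.mul_sum, mul_left_comm]

theorem centralValue_single (χ : G → ℂ) (g : G) (c : ℂ) :
    centralValue χ (MonoidAlgebra.single g c) = (χ 1)⁻¹ * (c * χ g) := by
  classical
  simp [centralValue, Finsupp.single_apply]

/-- A central element acts on an irreducible representation through its central character. -/
theorem asAlgebraHom_eq_centralValue_smul {V : Type*} [AddCommGroup V] [Module ℂ V]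
    [FiniteDimensional ℂ V] (ρ : Representation ℂ G V) (h : ρ.IsIrreducible) (z : Center G) :
    ρ.asAlgebraHom z = centralValue ρ.character z • (1 : Module.End ℂ V) := by
  let f : Representation.IntertwiningMap ρ ρ :=
    { toLinearMap := ρ.asAlgebraHom z
      isIntertwining' := fun g => by
        have := congrArg ρ.asAlgebraHom
          (Subalgebra.mem_center_iff.mp z.2 (MonoidAlgebra.of ℂ G g))
        rw [map_mul, map_mul, Representation.asAlgebraHom_of] at this
        exact this.symm }
  -- Schur's lemma over `ℂ`; the scalar `c` is then read off from the trace.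
  obtain ⟨c, hc⟩ :=
    Representation.IsIrreducible.algebraMap_intertwiningMap_bijective_of_isAlgClosed (ρ := ρ)
      |>.surjective f
  have hc' : ρ.asAlgebraHom z = c • (1 : Module.End ℂ V) := by
    ext v
    exact (congrArg (fun F : Representation.IntertwiningMap ρ ρ => F v) hc).symm
  have htr : ∀ u : MonoidAlgebra ℂ G,
      (ρ.character 1)⁻¹ * LinearMap.trace ℂ V (ρ.asAlgebraHom u) =
        centralValue ρ.character u := by
    intro u
    induction u using MonoidAlgebra.induction_linear with
    | zero => simp
    | add x y hx hy => rw [map_add, map_add, map_add, mul_add, hx, hy]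
    | single g a =>
      rw [centralValue_single, Representation.asAlgebraHom_single, map_smul, smul_eq_mul]
      rfl
  have h1 : ρ.character 1 ≠ 0 := Irr_apply_one_ne_zero (character_mem_Irr ρ h)
  rw [← htr, hc', map_smul, smul_eq_mul, LinearMap.trace_one, ← Representation.char_one ρ,
    mul_comm c, inv_mul_cancel_left₀ h1]

/-- Both sides are the scalar by which `z * w` acts; comparing traces and cancelling the degree `n ≠
0` equates them. -/
theorem centralValue_mul {χ : G → ℂ} (hχ : χ ∈ Irr G) (z w : Center G) :
    centralValue χ (z * w : Center G) = centralValue χ z * centralValue χ w := by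
  obtain ⟨n, ρ, hρ, rfl⟩ := hχ
  have h1 : (n : ℂ) ≠ 0 := by
    have := Irr_apply_one_ne_zero (character_mem_Irr ρ hρ)
    simpa using this
  have h := asAlgebraHom_eq_centralValue_smul ρ hρ (z * w)
  rw [Subalgebra.coe_mul, map_mul, asAlgebraHom_eq_centralValue_smul ρ hρ z,
    asAlgebraHom_eq_centralValue_smul ρ hρ w] at h
  have h' := congrArg (LinearMap.trace ℂ _) h
  rw [smul_mul_smul_comm, one_mul, map_smul, map_smul, LinearMap.trace_one, smul_eq_mul,
    smul_eq_mul] at h'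
  simpa [h1] using h'.symm

/-- A simple `ℂG`-module is an irreducible representation of finite degree, on which `z` acts by a
central character. -/
theorem smul_eq_zero_of_centralValue_eq_zero {M : Type*} [AddCommGroup M]
    [Module (MonoidAlgebra ℂ G) M] [IsSimpleModule (MonoidAlgebra ℂ G) M] {z : Center G}
    (hz : ∀ χ ∈ Irr G, centralValue χ z = 0) (m : M) : (z : MonoidAlgebra ℂ G) • m = 0 := by
  let _ : Module ℂ M := Module.compHom M (algebraMap ℂ (MonoidAlgebra ℂ G))
  have : IsScalarTower ℂ (MonoidAlgebra ℂ G) M :=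
    ⟨fun c u x => by rw [Algebra.smul_def, mul_smul]; rfl⟩
  have : FiniteDimensional ℂ M := Module.Finite.trans (MonoidAlgebra ℂ G) M
  let σ : Representation ℂ G M := Representation.ofModule' M
  have hact : ∀ (u : MonoidAlgebra ℂ G) (x : M), σ.asAlgebraHom u x = u • x := fun u x => by
    simp only [σ, Representation.ofModule', Representation.asAlgebraHom_def,
      Equiv.apply_symm_apply, Algebra.lsmul_coe]
  let e : σ.asModule ≃ₗ[MonoidAlgebra ℂ G] M :=
    { σ.asModuleEquiv.toAddEquiv with
      map_smul' := fun u x => (σ.asModuleEquiv_map_smul u x).trans (hact u _) }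
  have hσ : σ.IsIrreducible :=
    (Representation.irreducible_iff_isSimpleModule_asModule σ).mpr (IsSimpleModule.congr e)
  rw [← hact, asAlgebraHom_eq_centralValue_smul σ hσ z, hz _ (character_mem_Irr σ hσ), zero_smul,
    LinearMap.zero_apply]

/-- Central elements are separated by the irreducible characters. -/
theorem eq_zero_of_centralValue_eq_zero {z : Center G}
    (hz : ∀ χ ∈ Irr G, centralValue χ z = 0) : z = 0 := by
  have hne : NeZero (Nat.card G : ℂ) := ⟨Nat.cast_ne_zero.mpr Nat.card_pos.ne'⟩
  -- `z` kills the class of `1` in each simple quotient `ℂG ⧸ I`, so it lies in every maximal left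
  -- ideal.
  have hmem : (z : MonoidAlgebra ℂ G) ∈ Ring.jacobson (MonoidAlgebra ℂ G) := by
    rw [Ring.jacobson_eq_sInf_isMaximal, Ideal.mem_sInf]
    intro I hI
    have hI : I.IsMaximal := hI
    have hs : IsSimpleModule (MonoidAlgebra ℂ G) (MonoidAlgebra ℂ G ⧸ I) :=
      isSimpleModule_iff_isCoatom.mpr hI.out
    have h := smul_eq_zero_of_centralValue_eq_zero hz
      (Submodule.Quotient.mk 1 : MonoidAlgebra ℂ G ⧸ I)
    rw [← Submodule.Quotient.mk_smul, smul_eq_mul, mul_one] at h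
    exact (Submodule.Quotient.mk_eq_zero I).mp h
  -- Maschke's theorem: `ℂG` is semisimple, so its radical vanishes.
  rw [IsSemisimpleRing.jacobson_eq_bot] at hmem
  exact Subtype.ext hmem

/-! ### Class functions and class sums -/

omit [Fintype G] in
theorem Irr_apply_eq_of_mk_eq {χ : G → ℂ} (hχ : χ ∈ Irr G) {a b : G}
    (h : ConjClasses.mk a = ConjClasses.mk b) : χ a = χ b := by
  obtain ⟨n, ρ, -, rfl⟩ := hχ
  obtain ⟨c, rfl⟩ := isConj_iff.mp (ConjClasses.mk_eq_mk_iff_isConj.mp h)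
  exact (Representation.char_conj ρ a c).symm

omit [Fintype G] in
theorem mk_inv_eq {a b : G} (h : ConjClasses.mk a = ConjClasses.mk b) :
    ConjClasses.mk a⁻¹ = ConjClasses.mk b⁻¹ := by
  obtain ⟨c, rfl⟩ := isConj_iff.mp (ConjClasses.mk_eq_mk_iff_isConj.mp h)
  exact ConjClasses.mk_eq_mk_iff_isConj.mpr (isConj_iff.mpr ⟨c, by group⟩)

variable [DecidableEq G]

theorem card_filter_mk_eq (K : ConjClasses G) :
    (Finset.univ.filter fun a : G => ConjClasses.mk a = K).card = Nat.card K.carrier := by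
  classical
  rw [Nat.card_eq_fintype_card, Fintype.card_subtype]
  simp only [ConjClasses.mem_carrier_iff_mk_eq]

theorem sum_eq_sum_conjClasses {g : ConjClasses G → G}
    (f : G → ℂ) (hf : ∀ a K, ConjClasses.mk a = K → f a = f (g K)) :
    ∑ a : G, f a = ∑ K : ConjClasses G, (Nat.card K.carrier : ℂ) * f (g K) := by
  rw [← Finset.sum_fiberwise Finset.univ (ConjClasses.mk : G → ConjClasses G)]
  refine Finset.sum_congr rfl fun K _ => ?_
  rw [Finset.sum_congr rfl fun a ha => hf a K (Finset.mem_filter.mp ha).2, Finset.sum_const,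
    card_filter_mk_eq, nsmul_eq_mul]

-- Orbit-stabilizer for the conjugation action.
omit [Fintype G] [DecidableEq G] in
theorem card_carrier_mul_card_centralizer {g : ConjClasses G → G}
    (hg : ∀ K : ConjClasses G, ConjClasses.mk (g K) = K) (K : ConjClasses G) :
    Nat.card K.carrier * Nat.card (Subgroup.centralizer ({g K} : Set G)) = Nat.card G := by
  rw [Subgroup.nat_card_centralizer_nat_card_stabilizer,
    Nat.card_congr (ConjAct.toConjAct (G := G)).toEquiv, ← Nat.card_congr
    (MulAction.orbitProdStabilizerEquivGroup (ConjAct G) (g K)), Nat.card_prod,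
    ConjAct.orbit_eq_carrier_conjClasses, hg]

theorem coe_classSum (K : ConjClasses G) : (classSum K : MonoidAlgebra ℂ G) =
    ∑ a : G with ConjClasses.mk a = K, MonoidAlgebra.of ℂ G a := rfl

theorem coe_centerBar_classSum (K : ConjClasses G) :
    (centerBar (classSum K) : MonoidAlgebra ℂ G) =
      ∑ a : G with ConjClasses.mk a = K, MonoidAlgebra.of ℂ G a⁻¹ := by
  let F : MonoidAlgebra ℂ G →+ MonoidAlgebra ℂ G := ⟨⟨bar, bar_zero⟩, bar_add⟩
  change F (classSum K : MonoidAlgebra ℂ G) = _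
  rw [coe_classSum, map_sum]
  refine Finset.sum_congr rfl fun a _ => ?_
  change bar (MonoidAlgebra.single a 1) = _
  rw [bar_single, map_one]
  rfl

theorem centralValue_classSum {χ : G → ℂ} (hχ : χ ∈ Irr G) (a : G) :
    centralValue χ (classSum (ConjClasses.mk a) : MonoidAlgebra ℂ G) =
      (χ 1)⁻¹ * χ a * Nat.card (ConjClasses.mk a).carrier := by
  rw [coe_classSum, map_sum, Finset.sum_congr rfl (g := fun _ => (χ 1)⁻¹ * χ a),
    Finset.sum_const, card_filter_mk_eq, nsmul_eq_mul, mul_comm]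
  intro b hb
  rw [MonoidAlgebra.of_apply, centralValue_single, one_mul,
    Irr_apply_eq_of_mk_eq hχ (Finset.mem_filter.mp hb).2]

theorem centralValue_centerBar_classSum {χ : G → ℂ} (hχ : χ ∈ Irr G) (a : G) :
    centralValue χ (centerBar (classSum (ConjClasses.mk a)) : MonoidAlgebra ℂ G) =
      (χ 1)⁻¹ * χ a⁻¹ * Nat.card (ConjClasses.mk a).carrier := by
  rw [coe_centerBar_classSum, map_sum, Finset.sum_congr rfl (g := fun _ => (χ 1)⁻¹ * χ a⁻¹),
    Finset.sum_const, card_filter_mk_eq, nsmul_eq_mul, mul_comm]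
  intro b hb
  rw [MonoidAlgebra.of_apply, centralValue_single, one_mul,
    Irr_apply_eq_of_mk_eq hχ (mk_inv_eq (Finset.mem_filter.mp hb).2)]

theorem coeff_classSum (K : ConjClasses G) (a : G) :
    (classSum K : MonoidAlgebra ℂ G).coeff a = if ConjClasses.mk a = K then 1 else 0 := by
  rw [coe_classSum, MonoidAlgebra.coeff_sum]
  simp [Finsupp.finsetSum_apply, Finsupp.single_apply, Finset.sum_ite_eq']

-- Compare the coefficients of `c * a` in `[c] z = z [c]`.
omit [Fintype G] [DecidableEq G] in
theorem coeff_eq_of_mk_eq (z : Center G) {a b : G} (h : ConjClasses.mk a = ConjClasses.mk b) :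
    (z : MonoidAlgebra ℂ G).coeff a = (z : MonoidAlgebra ℂ G).coeff b := by
  obtain ⟨c, rfl⟩ := isConj_iff.mp (ConjClasses.mk_eq_mk_iff_isConj.mp h)
  have h := congrArg (fun u => u.coeff (c * a))
    (Subalgebra.mem_center_iff.mp z.2 (MonoidAlgebra.single c 1))
  simpa [MonoidAlgebra.coeff_single_mul_apply, MonoidAlgebra.coeff_mul_single_apply] using h

/-- Coordinates of a central element with respect to the class sums. -/
def centerEquivFun {g : ConjClasses G → G} (hg : ∀ K, ConjClasses.mk (g K) = K) :
    Center G ≃ₗ[ℂ] (ConjClasses G → ℂ) where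
  toFun z K := (z : MonoidAlgebra ℂ G).coeff (g K)
  map_add' z w := by ext; simp
  map_smul' c z := by ext; simp
  invFun f := ∑ K, f K • classSum K
  left_inv z := by
    apply Subtype.ext
    ext a
    simp only [AddSubmonoidClass.coe_finsetSum, SetLike.val_smul, MonoidAlgebra.coeff_sum,
      Finsupp.finsetSum_apply, MonoidAlgebra.coeff_smul_apply, coeff_classSum, smul_eq_mul, mul_ite,
      mul_one, mul_zero, Finset.sum_ite_eq, Finset.mem_univ, if_true]
    exact coeff_eq_of_mk_eq z (hg _)
  right_inv f := by
    ext K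
    simp [MonoidAlgebra.coeff_sum, Finsupp.finsetSum_apply, coeff_classSum, hg]

/-- The basis of the center formed by the class sums. -/
def classSumBasis {g : ConjClasses G → G} (hg : ∀ K, ConjClasses.mk (g K) = K) :
    Basis (ConjClasses G) ℂ (Center G) :=
  Basis.ofEquivFun (centerEquivFun hg)

theorem classSumBasis_apply {g : ConjClasses G → G} (hg : ∀ K, ConjClasses.mk (g K) = K)
    (K : ConjClasses G) : classSumBasis hg K = classSum K := by
  rw [classSumBasis, Basis.coe_ofEquivFun]
  change ∑ L, (Pi.single K 1 : ConjClasses G → ℂ) L • classSum L = _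
  simp [Pi.single_apply]

/-! ### Integrality of the Gram matrix -/

/-- In the basis of class sums, the diagonal entries of multiplication are coefficients of products
taken in `R`, the image of `ℤG`. -/
theorem exists_int_form_classSum (K L : ConjClasses G) :
    ∃ m : ℤ, form (classSum K) (classSum L) = m := by
  obtain ⟨g, hg⟩ : ∃ g : ConjClasses G → G, ∀ M, ConjClasses.mk (g M) = M :=
    ConjClasses.mk_surjective.hasRightInverse
  let R : Subring (MonoidAlgebra ℂ G) :=
    (MonoidAlgebra.mapRingHom G (Int.castRingHom ℂ)).range
  have hof : ∀ a, MonoidAlgebra.of ℂ G a ∈ R := fun a => ⟨MonoidAlgebra.single a 1, by simp⟩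
  have hcs : ∀ M : ConjClasses G, (classSum M : MonoidAlgebra ℂ G) ∈ R :=
    fun M => Subring.sum_mem _ fun a _ => hof a
  have hbar : (centerBar (classSum K) : MonoidAlgebra ℂ G) ∈ R := by
    rw [coe_centerBar_classSum]
    exact Subring.sum_mem _ fun a _ => hof a⁻¹
  have hcoeff : ∀ u ∈ R, ∀ a, u.coeff a ∈ (Int.castRingHom ℂ).range := by
    rintro _ ⟨v, rfl⟩ a
    exact ⟨v.coeff a, by simp⟩
  suffices h : form (classSum K) (classSum L) ∈ (Int.castRingHom ℂ).range by
    obtain ⟨m, hm⟩ := h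
    exact ⟨m, hm.symm⟩
  rw [form, Algebra.trace_eq_matrix_trace (classSumBasis hg), Matrix.trace]
  refine Subring.sum_mem _ fun M _ => ?_
  rw [Matrix.diag_apply, Algebra.leftMulMatrix_eq_repr_mul, classSumBasis_apply]
  exact hcoeff _ (R.mul_mem (R.mul_mem hbar (hcs L)) (hcs M)) _

/-! ### Evaluation at all central characters -/

variable (G) in
/-- The map `Z(ℂG) → ℂ^Irr(G)` given by the central characters. -/
def centralEval : Center G →ₗ[ℂ] (Irr G → ℂ) :=
  LinearMap.pi fun χ =>
    (centralValue (χ : G → ℂ)).comp (Subalgebra.center ℂ (MonoidAlgebra ℂ G)).val.toLinearMap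

omit [DecidableEq G] in
theorem centralEval_apply (z : Center G) (χ : Irr G) :
    centralEval G z χ = centralValue (χ : G → ℂ) z := rfl

omit [DecidableEq G] in
theorem sum_mul_inv_Irr (χ ψ : Irr G) [Decidable (χ = ψ)] :
    ∑ a : G, (χ : G → ℂ) a * (ψ : G → ℂ) a⁻¹ = if χ = ψ then (Nat.card G : ℂ) else 0 := by
  have h0 : (Nat.card G : ℂ) ≠ 0 := Nat.cast_ne_zero.mpr Nat.card_pos.ne'
  have : Invertible (Nat.card G : ℂ) := invertibleOfNonzero h0
  obtain ⟨χ, n, ρ, hρ, rfl⟩ := χ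
  obtain ⟨ψ, m, σ, hσ, rfl⟩ := ψ
  have := hρ
  have := hσ
  have h := Representation.char_orthonormal ρ σ
  rw [inv_mul_eq_iff_eq_mul₀ h0] at h
  -- Splitting on equality of characters rather than on isomorphism avoids proving that the
  -- character determines the representation: if they agree, `σ` is replaced by `ρ`.
  by_cases hc : ρ.character = σ.character
  · have h' := Representation.char_orthonormal ρ ρ
    rw [if_pos ⟨Representation.Equiv.refl ρ⟩, inv_mul_eq_iff_eq_mul₀ h0, mul_one] at h'
    rw [if_pos (Subtype.ext hc)]
    simp only [← hc]
    exact h'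
  · have hne : ¬ Nonempty (Representation.Equiv σ ρ) := by
      rintro ⟨φ⟩
      exact hc (Representation.char_iso φ).symm
    rw [if_neg hne, mul_zero] at h
    rw [if_neg fun hh => hc (congrArg Subtype.val hh)]
    exact h

theorem sum_card_mul_Irr_mul_inv {g : ConjClasses G → G} (hg : ∀ K, ConjClasses.mk (g K) = K)
    (χ ψ : Irr G) [Decidable (χ = ψ)] :
    ∑ K : ConjClasses G, (Nat.card K.carrier : ℂ) * ((χ : G → ℂ) (g K) * (ψ : G → ℂ) (g K)⁻¹) =
      if χ = ψ then (Nat.card G : ℂ) else 0 := by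
  rw [← sum_mul_inv_Irr, sum_eq_sum_conjClasses (g := g)]
  intro a K ha
  rw [Irr_apply_eq_of_mk_eq χ.2 (ha.trans (hg K).symm),
    Irr_apply_eq_of_mk_eq ψ.2 (mk_inv_eq (ha.trans (hg K).symm))]

/-- Injectivity is separation by characters; surjectivity comes from row orthogonality. The equality
of the numbers of characters and of classes is thus a consequence, not an input. -/
theorem centralEval_bijective : Function.Bijective (centralEval G) := by
  classical
  refine ⟨(injective_iff_map_eq_zero _).mpr fun z hz =>
    eq_zero_of_centralValue_eq_zero fun χ hχ => congrFun hz ⟨χ, hχ⟩, ?_⟩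
  obtain ⟨g, hg⟩ : ∃ g : ConjClasses G → G, ∀ M, ConjClasses.mk (g M) = M :=
    ConjClasses.mk_surjective.hasRightInverse
  have h0 : (Nat.card G : ℂ) ≠ 0 := Nat.cast_ne_zero.mpr Nat.card_pos.ne'
  -- These elements are nonzero multiples of the primitive central idempotents.
  have hE : ∀ ψ χ : Irr G, centralEval G (∑ K, (ψ : G → ℂ) (g K)⁻¹ • classSum K) χ =
      if χ = ψ then ((χ : G → ℂ) 1)⁻¹ * (Nat.card G : ℂ) else 0 := by
    intro ψ χ
    have h := congrArg (((χ : G → ℂ) 1)⁻¹ * ·) (sum_card_mul_Irr_mul_inv hg χ ψ)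
    simp only [Finset.mul_sum, mul_ite, mul_zero] at h
    rw [← h, map_sum, Finset.sum_apply]
    refine Finset.sum_congr rfl fun K _ => ?_
    have hK := centralValue_classSum χ.2 (g K)
    rw [hg] at hK
    rw [map_smul, Pi.smul_apply, centralEval_apply, hK, smul_eq_mul]
    ring
  intro f
  refine ⟨∑ ψ : Irr G, (f ψ * (((ψ : G → ℂ) 1)⁻¹ * (Nat.card G : ℂ))⁻¹) •
    ∑ K, (ψ : G → ℂ) (g K)⁻¹ • classSum K, ?_⟩
  ext χ
  rw [map_sum, Finset.sum_apply]
  simp only [map_smul, Pi.smul_apply, hE, smul_eq_mul, mul_ite, mul_zero, Finset.sum_ite_eq,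
    Finset.mem_univ, if_true]
  rw [inv_mul_cancel_right₀ (mul_ne_zero (inv_ne_zero (Irr_apply_one_ne_zero χ.2)) h0)]

variable (G) in
/-- The basis of primitive central idempotents. -/
def idempotentBasis : Basis (Irr G) ℂ (Center G) :=
  Basis.ofEquivFun (LinearEquiv.ofBijective (centralEval G) centralEval_bijective)

variable (G) in
theorem card_Irr : Fintype.card (Irr G) = Fintype.card (ConjClasses G) := by
  obtain ⟨g, hg⟩ : ∃ g : ConjClasses G → G, ∀ M, ConjClasses.mk (g M) = M :=
    ConjClasses.mk_surjective.hasRightInverse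
  exact Fintype.card_congr ((idempotentBasis G).indexEquiv (classSumBasis hg))

/-- Multiplication by `z` is diagonal in the idempotent basis, with entries `ω_χ(z)`. -/
theorem trace_eq_sum_centralValue (z : Center G) :
    Algebra.trace ℂ (Center G) z = ∑ χ : Irr G, centralValue (χ : G → ℂ) z := by
  classical
  have hrepr : ∀ w χ, (idempotentBasis G).repr w χ = centralValue (χ : G → ℂ) w := fun _ _ => rfl
  rw [Algebra.trace_eq_matrix_trace (idempotentBasis G), Matrix.trace]
  refine Finset.sum_congr rfl fun χ _ => ?_
  rw [Matrix.diag_apply, Algebra.leftMulMatrix_eq_repr_mul, hrepr, centralValue_mul χ.2,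
    ← hrepr (idempotentBasis G χ), Basis.repr_self, Finsupp.single_eq_same, mul_one]

/-! ### The Gram determinant -/

theorem form_classSum {g : ConjClasses G → G} (hg : ∀ K, ConjClasses.mk (g K) = K)
    (K L : ConjClasses G) : form (classSum K) (classSum L) =
      ∑ χ : Irr G, (((χ : G → ℂ) 1)⁻¹ * (χ : G → ℂ) (g K)⁻¹ * Nat.card K.carrier) *
        (((χ : G → ℂ) 1)⁻¹ * (χ : G → ℂ) (g L) * Nat.card L.carrier) := by
  rw [form, trace_eq_sum_centralValue]
  refine Finset.sum_congr rfl fun χ _ => ?_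
  have hK := centralValue_centerBar_classSum χ.2 (g K)
  have hL := centralValue_classSum χ.2 (g L)
  rw [hg] at hK hL
  rw [centralValue_mul χ.2, hK, hL]

/-- The Gram determinant of the class sums. -/
theorem det_gramMatrix_classSum {g : ConjClasses G → G}
    (hg : ∀ K, ConjClasses.mk (g K) = K) :
    (gramMatrix (classSum : ConjClasses G → Center G)).det =
      haradaNumber G ^ 2 * (centralizerProd g : ℂ) := by
  -- An arbitrary bijection, used only to make the character table square.
  let e : ConjClasses G ≃ Irr G := Fintype.equivOfCardEq (card_Irr G).symm
  let X : Matrix (ConjClasses G) (ConjClasses G) ℂ := Matrix.of fun K L => (e K : G → ℂ) (g L)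
  let Y : Matrix (ConjClasses G) (ConjClasses G) ℂ := Matrix.of fun K L => (e K : G → ℂ) (g L)⁻¹
  let C : Matrix (ConjClasses G) (ConjClasses G) ℂ :=
    Matrix.diagonal fun K => (Nat.card K.carrier : ℂ)
  let D : Matrix (ConjClasses G) (ConjClasses G) ℂ :=
    Matrix.diagonal fun K => ((e K : G → ℂ) 1)⁻¹
  have hgram : gramMatrix (classSum : ConjClasses G → Center G) =
      (D * Y * C).transpose * (D * X * C) := by
    ext K L
    rw [gramMatrix, Matrix.of_apply, form_classSum hg, ← e.sum_comp, Matrix.mul_apply]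
    refine Finset.sum_congr rfl fun M _ => ?_
    simp [X, Y, C, D]
  have horth : X * C * Y.transpose = Matrix.diagonal fun _ => (Nat.card G : ℂ) := by
    ext K L
    classical
    have h := sum_card_mul_Irr_mul_inv hg (e K) (e L)
    simp only [e.apply_eq_iff_eq] at h
    rw [Matrix.diagonal_apply, ← h, Matrix.mul_apply]
    refine Finset.sum_congr rfl fun M _ => ?_
    simp only [X, Y, C, Matrix.mul_diagonal, Matrix.of_apply, Matrix.transpose_apply]
    ring
  have hC : C.det = ∏ K : ConjClasses G, (Nat.card K.carrier : ℂ) := Matrix.det_diagonal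
  have hD : D.det = (∏ χ : Irr G, (χ : G → ℂ) 1)⁻¹ := by
    rw [Matrix.det_diagonal, Finset.prod_inv_distrib, e.prod_comp fun χ : Irr G => (χ : G → ℂ) 1]
  have hC0 : C.det ≠ 0 := by
    rw [hC]
    refine Finset.prod_ne_zero_iff.mpr fun K _ => Nat.cast_ne_zero.mpr ?_
    exact left_ne_zero_of_mul
      (ne_of_eq_of_ne (card_carrier_mul_card_centralizer hg K) Nat.card_pos.ne')
  have hXY : X.det * Y.det = (centralizerProd g : ℂ) := by
    have h := congrArg Matrix.det horth
    rw [Matrix.det_mul, Matrix.det_mul, Matrix.det_transpose,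
      Matrix.det_diagonal (d := fun _ => (Nat.card G : ℂ))] at h
    have hc : ∏ _K : ConjClasses G, (Nat.card G : ℂ) = C.det * (centralizerProd g : ℂ) := by
      rw [hC, centralizerProd, Nat.cast_prod, ← Finset.prod_mul_distrib]
      refine Finset.prod_congr rfl fun K _ => ?_
      rw [← Nat.cast_mul, card_carrier_mul_card_centralizer hg]
    rw [hc] at h
    exact mul_left_cancel₀ hC0 (by linear_combination h)
  rw [hgram, Matrix.det_mul, Matrix.det_transpose, Matrix.det_mul, Matrix.det_mul, Matrix.det_mul,
    Matrix.det_mul, haradaNumber, ← hXY, div_eq_mul_inv, ← hC, ← hD]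
  ring

theorem exists_int_det_gramMatrix_classSum :
    ∃ m : ℤ, (gramMatrix (classSum : ConjClasses G → Center G)).det = m := by
  choose f hf using exists_int_form_classSum (G := G)
  refine ⟨(Matrix.of f).det, ?_⟩
  rw [← eq_intCast (Int.castRingHom ℂ), RingHom.map_det]
  congr 1
  ext K L
  exact hf K L

variable (G) in
theorem exists_rat_haradaNumber : ∃ q : ℚ, 0 ≤ q ∧ haradaNumber G = q := by
  have hdeg : ∀ χ : Irr G, ∃ n : ℕ, (χ : G → ℂ) 1 = n := by
    rintro ⟨_, n, ρ, -, rfl⟩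
    exact ⟨n, by simp⟩
  choose d hd using hdeg
  refine ⟨(∏ K : ConjClasses G, (Nat.card K.carrier : ℚ)) / ∏ χ : Irr G, (d χ : ℚ),
    by positivity, ?_⟩
  simp [haradaNumber, hd]

end Harada

end

theorem mainTheorem1 (G : Type*) [Group G] [Fintype G] [DecidableEq G]
    (g : ConjClasses G → G) (hg : ∀ K : ConjClasses G, ConjClasses.mk (g K) = K) :
    ∃ m : ℤ, Harada.gammaG G = (m : ℝ) ∧
      (Harada.gammaG G : ℂ) = Harada.haradaNumber G ^ 2 * (Harada.centralizerProd g : ℂ) ∧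
      ((∃ n : ℤ, Harada.haradaNumber G = (n : ℂ)) ↔ (Harada.centralizerProd g : ℤ) ∣ m) := by
  obtain ⟨m, hm⟩ := Harada.exists_int_det_gramMatrix_classSum (G := G)
  obtain ⟨q, hq, hh⟩ := Harada.exists_rat_haradaNumber G
  have hc : Harada.centralizerProd g ≠ 0 := Finset.prod_ne_zero_iff.mpr fun _ _ => Nat.card_pos.ne'
  have hdet := Harada.det_gramMatrix_classSum hg
  have hmq : (m : ℚ) = q ^ 2 * (Harada.centralizerProd g : ℚ) := by
    rw [hm, hh] at hdet
    exact_mod_cast hdet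
  -- The determinant is its own absolute value.
  have hm0 : 0 ≤ m := by
    have : (0 : ℚ) ≤ m := hmq ▸ by positivity
    exact_mod_cast this
  have hγ : Harada.gammaG G = (m : ℝ) := by
    rw [Harada.gammaG, Harada.absGramDet, hm, Complex.norm_intCast, abs_of_nonneg]
    exact_mod_cast hm0
  refine ⟨m, hγ, ?_, ?_⟩
  · rw [hγ, ← hdet, hm, Complex.ofReal_intCast]
  · rw [hh]
    constructor
    · rintro ⟨n, hn⟩
      have hn : q = n := by exact_mod_cast hn
      rw [hn] at hmq
      exact ⟨n ^ 2, by rw [mul_comm]; exact_mod_cast hmq⟩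
    · rintro ⟨k, hk⟩
      have hk' : q ^ 2 = k := by
        have hc' : (Harada.centralizerProd g : ℚ) ≠ 0 := Nat.cast_ne_zero.mpr hc
        rw [hk, mul_comm] at hmq
        push_cast at hmq
        exact (mul_right_cancel₀ hc' hmq).symm
      -- `q` is a root of `x² - k`, and `ℤ` is integrally closed in `ℚ`.
      have hint : IsIntegral ℤ q := by
        refine IsIntegral.of_pow (n := 2) two_pos ?_
        rw [hk']
        exact isIntegral_algebraMap (x := k)
      obtain ⟨n, hn⟩ := IsIntegrallyClosed.isIntegral_iff.mp hint
      refine ⟨n, ?_⟩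
      rw [← hn]
      simp
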